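/- For $\tau$ in the upper half-plane $\mathbb{H}$ let $q=e^{2\pi i\tau}$, let $\eta(\tau)=e^{2\pi i\tau/24}\prod_{n\ge1}(1-q^n)$ be the Dedekind eta function and let $E_2(\tau)=1-24\sum_{n\ge1}\sigma_1(n)q^n$ be the normalised Eisenstein series of weight two, where $\sigma_1(n)=\sum_{d\mid n}d$. Put $$E_b(\tau)=\frac{(\eta(3\tau)\eta(2\tau))^7}{(\eta(6\tau)\eta(\tau))^5},\qquad t_6(\tau)=\left(\frac{\eta(6\tau)\eta(\tau)}{\eta(3\tau)\eta(2\tau)}\right)^{12},$$ $$E^0_6(\tau)=E_2(\tau)-10E_2(2\tau)+15E_2(3\tau)-6E_2(6\tau),\qquad E^1_6(\tau)=3E_2(3\tau)-2E_2(2\tau).$$ Then, for every $\tau\in\mathbb{H}$, $$E_b(\tau)\,t_6(\tau)=-\frac1{24}E^0_6(\tau),\qquad E_b(\tau)\,(1-5t_6(\tau))=E^1_6(\tau).$$ Equivalently, as meromorphic functions on $\mathbb{H}$, $$E_b=-\frac1{24}\,\frac{E^0_6}{t_6},\qquad E_b=\frac{E^1_6}{1-5t_6}.$$ Here $t_6$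 has no zeros on $\mathbb{H}$, so the first quotient identity holds at every point; the zeros of $1-5t_6$ are isolated, and the second quotient identity holds at every point where $1-5t_6\neq0$. -/

import Mathlib

open scoped UpperHalfPlane Topology

noncomputable section

namespace LevelSix

/-- The point `d τ` of the upper half-plane, for a positive integer `d`. -/
def scale (d : ℕ+) (τ : ℍ) : ℍ :=
  ⟨(d : ℂ) * (τ : ℂ), by simpa using mul_pos (Nat.cast_pos.mpr d.pos) τ.im_pos⟩

/-- The function `τ ↦ η(d τ)`, with `η` the Dedekind eta function. -/
def etaAt (d : ℕ+) (τ : ℍ) : ℂ := ModularForm.eta (scale d τ)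

/-- The function `τ ↦ E₂(d τ)`, with `E₂ = 1 - 24 ∑ σ₁(n) qⁿ` the normalised quasimodular
Eisenstein series of weight two. -/
def E2At (d : ℕ+) (τ : ℍ) : ℂ := EisensteinSeries.E2 (scale d τ)

/-- Beukers' weight two form, as an eta-quotient. -/
def Eb (τ : ℍ) : ℂ := (etaAt 3 τ * etaAt 2 τ) ^ 7 / (etaAt 6 τ * etaAt 1 τ) ^ 5

/-- The Hauptmodul `t₆`, as an eta-quotient. -/
def t6 (τ : ℍ) : ℂ := ((etaAt 6 τ * etaAt 1 τ) / (etaAt 3 τ * etaAt 2 τ)) ^ 12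

/-- `E⁰₆(τ) = E₂(τ) - 10 E₂(2τ) + 15 E₂(3τ) - 6 E₂(6τ)`. -/
def E60 (τ : ℍ) : ℂ := E2At 1 τ - 10 * E2At 2 τ + 15 * E2At 3 τ - 6 * E2At 6 τ

/-- `E¹₆(τ) = 3 E₂(3τ) - 2 E₂(2τ)`. -/
def E61 (τ : ℍ) : ℂ := 3 * E2At 3 τ - 2 * E2At 2 τ

end LevelSix

end

namespace LevelSix

open UpperHalfPlane hiding I
open Complex ModularForm EisensteinSeries Filter Asymptotics
open scoped MatrixGroups Real Manifold

/-! Both identities say that a combination `∑ c_δ E₂(δτ)` over δ ∣ 6 is a constant times an eta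
quotient `∏ η(δτ)^{e_δ}`: directly for `E60`, and for `Eb` after rewriting the second identity,
using the first, as `Eb = E61 - (5/24) E60`.

The condition `∑ c_δ/δ = 0` cancels the quasimodular correction of `E₂`, and `∑ e_δ = 4` gives the
eta quotient weight 2. Since `η²⁴ = Δ`, the 24th power of the ratio has no eta multiplier: it is a
holomorphic weight-zero function invariant under Γ₀(6). Comparing orders of vanishing shows that it
is bounded at the four cusps, hence constant (`exists_eisRatio_eq_const`). Thus the ratio itself
takes finitely many values on the connected half-plane, so it is constant, and its limit at i∞
identifies the value (`eisSum_eq_mul_etaProd`). -/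

/-- The point `(a τ + b) / d` of the upper half-plane. -/
noncomputable def affinePoint (a d : ℕ+) (b : ℤ) (τ : ℍ) : ℍ :=
  ⟨((a : ℂ) * τ + b) / d, by
    have h : (((a : ℂ) * τ + b) / d).im = a * τ.im / d := by simp
    rw [h]
    have := τ.im_pos
    positivity⟩

lemma coe_affinePoint (a d : ℕ+) (b : ℤ) (τ : ℍ) :
    (affinePoint a d b τ : ℂ) = ((a : ℂ) * τ + b) / d := rfl

lemma coe_scale (d : ℕ+) (τ : ℍ) : (scale d τ : ℂ) = d * τ := rfl

lemma affinePoint_im (a d : ℕ+) (b : ℤ) (τ : ℍ) :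
    (affinePoint a d b τ).im = a / d * τ.im := by
  change (((a : ℂ) * τ + b) / d).im = _
  simp
  ring

lemma affinePoint_one_zero (d : ℕ+) (τ : ℍ) : affinePoint d 1 0 τ = scale d τ := by
  ext
  simp [coe_affinePoint, coe_scale]

/-! ### Transformation of Δ(δτ) and E₂(δτ) -/

lemma discriminant_smul (γ : SL(2, ℤ)) (τ : ℍ) :
    discriminant (γ • τ) = denom γ τ ^ 12 * discriminant τ := by
  have h := congrFun (SlashInvariantForm.slash_action_generators_SL2Z
    discriminant_S_invariant discriminant_T_invariant γ) τ
  rw [SL_slash_apply, zpow_neg] at h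
  have h0 : denom γ τ ^ (12 : ℤ) ≠ 0 := zpow_ne_zero _ (denom_ne_zero γ τ)
  rw [mul_inv_eq_iff_eq_mul₀ h0] at h
  rw [h, mul_comm]
  norm_cast

lemma E2_smul (γ : SL(2, ℤ)) (τ : ℍ) :
    E2 (γ • τ) = denom γ τ ^ 2 * E2 τ + 6 / (π * I) * (γ 1 0 : ℂ) * denom γ τ := by
  have h := congrFun (E2_slash_action γ) τ
  rw [SL_slash_apply, zpow_neg] at h
  have h0 : denom γ τ ≠ 0 := denom_ne_zero γ τ
  rw [mul_inv_eq_iff_eq_mul₀ (zpow_ne_zero _ h0)] at h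
  rw [h]
  have hpi : (π : ℂ) ≠ 0 := by exact_mod_cast Real.pi_ne_zero
  simp only [Pi.sub_apply, Pi.smul_apply, D2, riemannZeta_two, smul_eq_mul]
  have : (6 : ℂ) / (π * I) = -(6 * I / π) := by
    field_simp
    simp
  rw [this]
  rw [zpow_ofNat]
  field_simp
  ring

/-- The matrix `diag(δ, 1) * γ` is the product of a matrix of `SL(2, ℤ)` and the upper triangular
matrix with first row `(a, b)` and second row `(0, d)`. -/
def IsTriangular (γ : SL(2, ℤ)) (δ a d : ℕ+) (b : ℤ) : Prop :=
  a * d = δ ∧ ∃ γ' : SL(2, ℤ), (δ : ℤ) * γ 0 0 = γ' 0 0 * a ∧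
    (δ : ℤ) * γ 0 1 = γ' 0 0 * b + γ' 0 1 * d ∧ γ 1 0 = γ' 1 0 * a ∧
    γ 1 1 = γ' 1 0 * b + γ' 1 1 * d

lemma denom_SL (γ : SL(2, ℤ)) (τ : ℍ) : denom γ τ = (γ 1 0 : ℂ) * τ + (γ 1 1 : ℂ) := by
  simp [ModularGroup.denom_apply]

lemma coe_SL_smul (γ : SL(2, ℤ)) (τ : ℍ) :
    ((γ • τ : ℍ) : ℂ) = ((γ 0 0 : ℂ) * τ + (γ 0 1 : ℂ)) / ((γ 1 0 : ℂ) * τ + (γ 1 1 : ℂ)) := by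
  rw [coe_specialLinearGroup_apply]
  simp

/-- The last equation makes the correction term of `E2` at level δ proportional to `1/δ`, whichever
triangular matrix is used. This is the source of the condition `∑ c_δ/δ = 0`. -/
lemma IsTriangular.exists_smul {γ : SL(2, ℤ)} {δ a d : ℕ+} {b : ℤ} (h : IsTriangular γ δ a d b) :
    ∃ γ' : SL(2, ℤ), ∀ τ : ℍ, scale δ (γ • τ) = γ' • affinePoint a d b τ ∧
      denom γ' (affinePoint a d b τ) = denom γ τ / d ∧ (γ' 1 0 : ℂ) / d = (γ 1 0 : ℂ) / δ := by
  obtain ⟨had, γ', h1, h2, h3, h4⟩ := h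
  have hd : (d : ℂ) ≠ 0 := by simp
  have ha : (a : ℂ) ≠ 0 := by simp
  have had' : (a : ℂ) * d = δ := by exact_mod_cast congrArg (fun n : ℕ+ ↦ ((n : ℕ) : ℂ)) had
  have h1' : (δ : ℂ) * γ 0 0 = γ' 0 0 * a := by exact_mod_cast congrArg (Int.cast : ℤ → ℂ) h1
  have h2' : (δ : ℂ) * γ 0 1 = γ' 0 0 * b + γ' 0 1 * d := by
    exact_mod_cast congrArg (Int.cast : ℤ → ℂ) h2
  have h3' : (γ 1 0 : ℂ) = γ' 1 0 * a := by exact_mod_cast congrArg (Int.cast : ℤ → ℂ) h3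
  have h4' : (γ 1 1 : ℂ) = γ' 1 0 * b + γ' 1 1 * d := by
    exact_mod_cast congrArg (Int.cast : ℤ → ℂ) h4
  refine ⟨γ', fun τ ↦ ?_⟩
  have hden : denom γ' (affinePoint a d b τ) = denom γ τ / d := by
    rw [denom_SL, denom_SL, coe_affinePoint, h3', h4']
    field_simp
    ring
  refine ⟨?_, hden, ?_⟩
  · have h0 := denom_ne_zero γ τ
    rw [denom_SL] at h0 hden
    rw [denom_SL] at hden
    ext
    rw [coe_scale, coe_SL_smul, coe_SL_smul, hden, coe_affinePoint]
    generalize (γ 1 0 : ℂ) * τ + (γ 1 1 : ℂ) = D at h0 ⊢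
    field_simp
    linear_combination (τ : ℂ) * h1' + h2'
  · rw [h3', ← had']
    field_simp

lemma IsTriangular.discriminant_scale {γ : SL(2, ℤ)} {δ a d : ℕ+} {b : ℤ}
    (h : IsTriangular γ δ a d b) (τ : ℍ) : discriminant (scale δ (γ • τ)) =
      denom γ τ ^ 12 * (discriminant (affinePoint a d b τ) / d ^ 12) := by
  obtain ⟨γ', h⟩ := h.exists_smul
  obtain ⟨h1, h2, -⟩ := h τ
  rw [h1, discriminant_smul, h2, div_pow]
  ring

lemma IsTriangular.E2_scale {γ : SL(2, ℤ)} {δ a d : ℕ+} {b : ℤ}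
    (h : IsTriangular γ δ a d b) (τ : ℍ) : E2 (scale δ (γ • τ)) =
      denom γ τ ^ 2 * (E2 (affinePoint a d b τ) / d ^ 2) +
        6 / (π * I) * (γ 1 0 : ℂ) * denom γ τ / δ := by
  obtain ⟨γ', h⟩ := h.exists_smul
  obtain ⟨h1, h2, h3⟩ := h τ
  rw [h1, E2_smul, h2, div_pow]
  linear_combination 6 / (π * I) * denom γ τ * h3

/-- The divisors of `6`. -/
def divisor : Fin 4 → ℕ+ := ![1, 2, 3, 6]

/-- The combination `∑ c_δ E₂(δ τ)` over the divisors `δ` of `6`. -/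
noncomputable def eisSum (c : Fin 4 → ℂ) (τ : ℍ) : ℂ := ∑ i, c i * E2 (scale (divisor i) τ)

/-- The product `∏ Δ(δ τ) ^ e_δ` over the divisors `δ` of `6`. -/
noncomputable def discProd (e : Fin 4 → ℤ) (τ : ℍ) : ℂ :=
  ∏ i, discriminant (scale (divisor i) τ) ^ e i

/-- The quotient of the `24`-th power of an Eisenstein sum by a product of discriminants. -/
noncomputable def eisRatio (c : Fin 4 → ℂ) (e : Fin 4 → ℤ) (τ : ℍ) : ℂ :=
  eisSum c τ ^ 24 / discProd e τ

section transformation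

variable {γ : SL(2, ℤ)} {a d : Fin 4 → ℕ+} {b : Fin 4 → ℤ}

lemma eisSum_smul (h : ∀ i, IsTriangular γ (divisor i) (a i) (d i) (b i)) {c : Fin 4 → ℂ}
    (hc : ∑ i, c i / divisor i = 0) (τ : ℍ) : eisSum c (γ • τ) =
      denom γ τ ^ 2 * ∑ i, c i / d i ^ 2 * E2 (affinePoint (a i) (d i) (b i) τ) := by
  have : eisSum c (γ • τ) = denom γ τ ^ 2 *
      ∑ i, c i / d i ^ 2 * E2 (affinePoint (a i) (d i) (b i) τ) +
      6 / (π * I) * (γ 1 0 : ℂ) * denom γ τ * ∑ i, c i / divisor i := by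
    rw [eisSum, Finset.mul_sum, Finset.mul_sum, ← Finset.sum_add_distrib]
    refine Finset.sum_congr rfl fun i _ ↦ ?_
    rw [(h i).E2_scale]
    ring
  rw [this, hc, mul_zero, add_zero]

lemma discProd_smul (h : ∀ i, IsTriangular γ (divisor i) (a i) (d i) (b i)) {e : Fin 4 → ℤ}
    (he : ∑ i, e i = 4) (τ : ℍ) : discProd e (γ • τ) = denom γ τ ^ 48 *
      ∏ i, (discriminant (affinePoint (a i) (d i) (b i) τ) / (d i : ℂ) ^ 12) ^ e i := by
  have h0 : denom γ τ ^ 12 ≠ 0 := pow_ne_zero _ (denom_ne_zero γ τ)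
  have h4 : denom γ τ ^ 48 = ∏ i, (denom γ τ ^ 12) ^ e i := by
    have : denom γ τ ^ 48 = (denom γ τ ^ 12) ^ (∑ i, e i) := by
      rw [he]; norm_cast; rw [← pow_mul]
    rw [this, Fin.sum_univ_four, Fin.prod_univ_four, zpow_add₀ h0, zpow_add₀ h0, zpow_add₀ h0]
  rw [h4, discProd, ← Finset.prod_mul_distrib]
  refine Finset.prod_congr rfl fun i _ ↦ ?_
  rw [(h i).discriminant_scale, mul_zpow]

/-- The automorphy factors cancel: 2 · 24 = 48 above and 12 · 4 = 48 below. -/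
lemma eisRatio_smul (h : ∀ i, IsTriangular γ (divisor i) (a i) (d i) (b i)) {c : Fin 4 → ℂ}
    {e : Fin 4 → ℤ} (hc : ∑ i, c i / divisor i = 0) (he : ∑ i, e i = 4) (τ : ℍ) :
    eisRatio c e (γ • τ) =
      (∑ i, c i / d i ^ 2 * E2 (affinePoint (a i) (d i) (b i) τ)) ^ 24 /
      ∏ i, (discriminant (affinePoint (a i) (d i) (b i) τ) / (d i : ℂ) ^ 12) ^ e i := by
  have h0 : denom γ τ ≠ 0 := denom_ne_zero γ τ
  rw [eisRatio, eisSum_smul h hc, discProd_smul h he, mul_pow, ← pow_mul]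
  exact mul_div_mul_left _ _ (pow_ne_zero _ h0)

end transformation

lemma isTriangular_of_mem_Gamma0 {γ : SL(2, ℤ)} (hγ : γ ∈ CongruenceSubgroup.Gamma0 6) (i : Fin 4) :
    IsTriangular γ (divisor i) (divisor i) 1 0 := by
  refine ⟨mul_one _, ?_⟩
  have h6 : ((divisor i : ℕ) : ℤ) ∣ γ 1 0 := by
    have h : (6 : ℤ) ∣ γ 1 0 := by
      exact (ZMod.intCast_zmod_eq_zero_iff_dvd _ 6).mp (CongruenceSubgroup.Gamma0_mem.mp hγ)
    refine dvd_trans ?_ h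
    fin_cases i <;> simp [divisor]
  obtain ⟨m, hm⟩ := h6
  have hdet := γ.det_coe
  rw [Matrix.det_fin_two] at hdet
  refine ⟨⟨!![γ 0 0, divisor i * γ 0 1; m, γ 1 1], ?_⟩, ?_, ?_, ?_, ?_⟩
  · rw [Matrix.det_fin_two_of]
    rw [hm] at hdet
    linear_combination hdet
  · simp [mul_comm]
  · simp
  · simp [hm, mul_comm]
  · simp

lemma eisRatio_smul_of_mem_Gamma0 {γ : SL(2, ℤ)} (hγ : γ ∈ CongruenceSubgroup.Gamma0 6)
    {c : Fin 4 → ℂ} {e : Fin 4 → ℤ} (hc : ∑ i, c i / divisor i = 0) (he : ∑ i, e i = 4) (τ : ℍ) :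
    eisRatio c e (γ • τ) = eisRatio c e τ := by
  rw [eisRatio_smul (isTriangular_of_mem_Gamma0 hγ) hc he]
  simp [eisRatio, eisSum, discProd, affinePoint_one_zero]

/-! ### Growth as Im τ → ∞ -/

section asymptotics

local notation "𝕢" => Function.Periodic.qParam

lemma E2_vadd_one (τ : ℍ) : E2 ((1 : ℝ) +ᵥ τ) = E2 τ := by
  have h := E2_smul ModularGroup.T τ
  rw [modular_T_smul] at h
  rw [h, denom_SL]
  simp [ModularGroup.T]

lemma periodic_E2 : Function.Periodic (E2 ∘ ofComplex) (1 : ℝ) := by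
  intro z
  rcases lt_or_ge 0 z.im with hz | hz
  · have hz' : 0 < (z + (1 : ℝ)).im := by simpa using hz
    simp only [Function.comp_apply]
    rw [ofComplex_apply_of_im_pos hz, ofComplex_apply_of_im_pos hz', ← E2_vadd_one ⟨z, hz⟩]
    congr 1
    ext
    simp [add_comm]
  · have hz' : (z + (1 : ℝ)).im ≤ 0 := by simpa using hz
    simp only [Function.comp_apply]
    rw [ofComplex_apply_of_im_nonpos hz, ofComplex_apply_of_im_nonpos hz']

lemma hasFPowerSeries_cuspFunction_E2 : HasFPowerSeriesOnBall (cuspFunction 1 E2)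
    (.ofScalars ℂ fun m : ℕ ↦ if m = 0 then 1 else -24 * (ArithmeticFunction.sigma 1 m : ℂ)) 0 1 :=
  hasFPowerSeriesOnBall_cuspFunction one_pos
    (analyticAt_cuspFunction_zero one_pos periodic_E2 E2_mdifferentiable isBoundedAtImInfty_E2)
    fun τ ↦ by
      simpa only [Function.Periodic.qParam, ofReal_one, div_one] using hasSum_qExpansion_E2 (z := τ)

lemma hasDerivAt_cuspFunction_E2 : HasDerivAt (cuspFunction 1 E2) (-24) 0 := by
  convert! hasFPowerSeries_cuspFunction_E2.hasFPowerSeriesAt.hasDerivAt using 1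
  simp [FormalMultilinearSeries.ofScalars]

lemma cuspFunction_E2_zero : cuspFunction 1 E2 0 = 1 := by
  rw [← hasFPowerSeries_cuspFunction_E2.coeff_zero ![]]
  simp [FormalMultilinearSeries.ofScalars]

lemma cuspFunction_E2_qParam (τ : ℍ) : cuspFunction 1 E2 (𝕢 1 τ) = E2 τ :=
  eq_cuspFunction τ one_ne_zero periodic_E2

lemma norm_qParam_one (τ : ℍ) : ‖𝕢 1 (τ : ℂ)‖ = Real.exp (-2 * π * τ.im) := by
  simp [Function.Periodic.qParam, Complex.norm_exp]

lemma isBigO_E2_sub_one :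
    (fun τ : ℍ ↦ E2 τ - 1) =O[atImInfty] fun τ ↦ Real.exp (-2 * π * τ.im) := by
  have h := hasDerivAt_cuspFunction_E2.isBigO_sub.comp_tendsto (qParam_tendsto_atImInfty one_pos)
  simp only [Function.comp_def, cuspFunction_E2_zero, cuspFunction_E2_qParam, sub_zero] at h
  exact h.trans (isBigO_of_le _ fun τ ↦ by simp [norm_qParam_one])

lemma tendsto_E2_sub_one_div_qParam :
    Tendsto (fun τ : ℍ ↦ (E2 τ - 1) / 𝕢 1 (τ : ℂ)) atImInfty (𝓝 (-24)) := by
  have hq : Tendsto (fun τ : ℍ ↦ 𝕢 1 (τ : ℂ)) atImInfty (𝓝[≠] 0) :=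
    tendsto_nhdsWithin_iff.mpr ⟨qParam_tendsto_atImInfty one_pos,
      .of_forall fun τ ↦ Function.Periodic.qParam_ne_zero _⟩
  have h := hasDerivAt_cuspFunction_E2.tendsto_slope.comp hq
  refine h.congr fun τ ↦ ?_
  simp [slope_def_field, cuspFunction_E2_zero, cuspFunction_E2_qParam]

lemma isTheta_discriminant :
    discriminant =Θ[atImInfty] fun τ : ℍ ↦ Real.exp (-2 * π * τ.im) := by
  refine ⟨?_, exp_isBigO_discriminant⟩
  simpa using CuspFormClass.exp_decay_atImInfty (h := 1) CuspForm.discriminant one_pos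
    one_mem_strictPeriods_SL

lemma tendsto_affinePoint (a d : ℕ+) (b : ℤ) :
    Tendsto (affinePoint a d b) atImInfty atImInfty := by
  rw [atImInfty, tendsto_comap_iff]
  have h : (UpperHalfPlane.im ∘ affinePoint a d b) = fun τ : ℍ ↦ (a / d : ℝ) * τ.im := by
    ext τ
    exact affinePoint_im a d b τ
  rw [h]
  exact tendsto_comap.const_mul_atTop (by positivity)

lemma tendsto_scale (d : ℕ+) : Tendsto (scale d) atImInfty atImInfty := by
  rw [show scale d = affinePoint d 1 0 from funext fun τ ↦ (affinePoint_one_zero d τ).symm]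
  exact tendsto_affinePoint d 1 0

lemma isBigO_E2_affinePoint {a d : ℕ+} {r : ℝ} (hr : r ≤ a / d) (b : ℤ) :
    (fun τ ↦ E2 (affinePoint a d b τ) - 1) =O[atImInfty]
      fun τ : ℍ ↦ Real.exp (-2 * π * (r * τ.im)) := by
  refine (isBigO_E2_sub_one.comp_tendsto (tendsto_affinePoint a d b)).trans
    (isBigO_of_le _ fun τ ↦ ?_)
  simp only [Function.comp_apply, affinePoint_im, Real.norm_eq_abs, Real.abs_exp]
  rw [Real.exp_le_exp]
  have := mul_le_mul_of_nonneg_right hr τ.im_pos.le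
  nlinarith [Real.pi_pos]

lemma isTheta_discriminant_affinePoint (a d : ℕ+) (b : ℤ) :
    (fun τ ↦ discriminant (affinePoint a d b τ) / (d : ℂ) ^ 12) =Θ[atImInfty]
      fun τ : ℍ ↦ Real.exp (-2 * π * (a / d * τ.im)) := by
  have h : (fun τ ↦ discriminant (affinePoint a d b τ)) =Θ[atImInfty]
      fun τ : ℍ ↦ Real.exp (-2 * π * (a / d * τ.im)) := by
    have h := tendsto_affinePoint a d b
    simp_rw [← affinePoint_im (b := b)]
    exact ⟨isTheta_discriminant.1.comp_tendsto h, isTheta_discriminant.2.comp_tendsto h⟩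
  simp_rw [div_eq_inv_mul _ ((d : ℂ) ^ 12)]
  exact (isTheta_const_mul_left (by simp)).mpr h

variable {γ : SL(2, ℤ)} {a d : Fin 4 → ℕ+} {b : Fin 4 → ℤ}

/-- Each `E2 - 1` decays at rate `a i / d i`, so any common lower bound `r` serves. The constant
terms must cancel, except when `r = 0`, where only boundedness is claimed. -/
lemma isBigO_sum_E2_affinePoint {c : Fin 4 → ℂ} {r : ℝ}
    (hr : ∀ i, r ≤ a i / d i) (hc : r = 0 ∨ ∑ i, c i / (d i : ℂ) ^ 2 = 0) :
    (fun τ ↦ ∑ i, c i / (d i : ℂ) ^ 2 * E2 (affinePoint (a i) (d i) (b i) τ)) =O[atImInfty]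
      fun τ : ℍ ↦ Real.exp (-2 * π * (r * τ.im)) := by
  have h : (fun τ ↦ ∑ i, c i / (d i : ℂ) ^ 2 * E2 (affinePoint (a i) (d i) (b i) τ)) =
      fun τ ↦ (∑ i, c i / (d i : ℂ) ^ 2 * (E2 (affinePoint (a i) (d i) (b i) τ) - 1)) +
        ∑ i, c i / (d i : ℂ) ^ 2 := by
    ext τ
    rw [← Finset.sum_add_distrib]
    exact Finset.sum_congr rfl fun i _ ↦ by ring
  rw [h]
  refine IsBigO.add (IsBigO.fun_sum fun i _ ↦ (isBigO_E2_affinePoint (hr i) (b i)).const_mul_left _)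
    ?_
  rcases hc with rfl | hc
  · simpa using isBigO_const_const _ (one_ne_zero (α := ℝ)) _
  · rw [hc]
    exact isBigO_zero _ _

/-- The order of vanishing condition for an Eisenstein quotient to be bounded at a cusp. -/
lemma isBigO_eisRatio_smul (h : ∀ i, IsTriangular γ (divisor i) (a i) (d i) (b i))
    {c : Fin 4 → ℂ} {e : Fin 4 → ℤ} {r : ℝ} (hcδ : ∑ i, c i / divisor i = 0) (he : ∑ i, e i = 4)
    (hr : ∀ i, r ≤ a i / d i) (hc : r = 0 ∨ ∑ i, c i / (d i : ℂ) ^ 2 = 0)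
    (hord : ∑ i, e i * (a i / d i : ℝ) ≤ 24 * r) :
    (fun τ ↦ eisRatio c e (γ • τ)) =O[atImInfty] fun _ ↦ (1 : ℝ) := by
  simp_rw [eisRatio_smul h hcδ he]
  have h1 := (isBigO_sum_E2_affinePoint (b := b) hr hc).pow 24
  have h2 := IsTheta.finsetProd (s := Finset.univ) fun i _ ↦
    (isTheta_discriminant_affinePoint (a i) (d i) (b i)).zpow (e i)
  refine (h1.mul h2.inv.isBigO).trans (isBigO_of_le _ fun τ ↦ ?_)
  have hz (x : ℝ) (n : ℤ) : Real.exp x ^ n = Real.exp (n * x) := by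
    rw [mul_comm, Real.exp_mul, Real.rpow_intCast]
  simp only [hz, ← Real.exp_sum, ← Real.exp_nat_mul, ← Real.exp_neg,
    ← Real.exp_add, Real.norm_eq_abs, Real.abs_exp, abs_one]
  rw [← Real.exp_zero, Real.exp_le_exp]
  have h3 : ∑ i, (e i : ℝ) * (-2 * π * (a i / d i * τ.im)) =
      -2 * π * τ.im * ∑ i, e i * (a i / d i : ℝ) := by
    rw [Finset.mul_sum]
    exact Finset.sum_congr rfl fun i _ ↦ by ring
  rw [h3]
  have := mul_le_mul_of_nonneg_left hord (mul_pos Real.pi_pos τ.im_pos).le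
  push_cast
  nlinarith

end asymptotics

/-! ### The cusps of Γ₀(6) -/

/-- The matrix with rows `(1, 0)` and `(k, 1)`. -/
def lowerUnipotent (k : Fin 4) : SL(2, ℤ) := ⟨!![1, 0; (k : ℤ), 1], by simp⟩

/-- The upper left entries of the triangular matrices for `lowerUnipotent k`. -/
def cuspA : Fin 4 → Fin 4 → ℕ+ :=
  ![![1, 2, 3, 6], ![1, 1, 1, 1], ![1, 2, 1, 2], ![1, 1, 3, 3]]

/-- The lower right entries of the triangular matrices for `lowerUnipotent k`. -/
def cuspD : Fin 4 → Fin 4 → ℕ+ :=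
  ![![1, 1, 1, 1], ![1, 2, 3, 6], ![1, 1, 3, 3], ![1, 2, 1, 2]]

/-- The upper right entries of the triangular matrices for `lowerUnipotent k`. -/
def cuspB : Fin 4 → Fin 4 → ℤ :=
  ![![0, 0, 0, 0], ![1, 1, 1, 1], ![0, 0, 2, 1], ![0, 1, 0, 1]]

/-- The unimodular factors in the triangularisations for `lowerUnipotent k`. -/
def cuspMatrix : Fin 4 → Fin 4 → Matrix (Fin 2) (Fin 2) ℤ :=
  ![![1, 1, 1, 1],
    ![!![1, -1; 1, 0], !![2, -1; 1, 0], !![3, -1; 1, 0], !![6, -1; 1, 0]],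
    ![!![1, 0; 2, 1], !![1, 0; 1, 1], !![3, -2; 2, -1], !![3, -1; 1, 0]],
    ![!![1, 0; 3, 1], !![2, -1; 3, -1], !![1, 0; 1, 1], !![2, -1; 1, 0]]]

lemma det_cuspMatrix (k i : Fin 4) : (cuspMatrix k i).det = 1 := by
  rw [Matrix.det_fin_two]
  revert k i
  decide

lemma isTriangular_lowerUnipotent (k i : Fin 4) :
    IsTriangular (lowerUnipotent k) (divisor i) (cuspA k i) (cuspD k i) (cuspB k i) := by
  refine ⟨?_, ⟨cuspMatrix k i, det_cuspMatrix k i⟩, ?_, ?_, ?_, ?_⟩ <;>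
  · revert k i
    decide

lemma coe_inv_lowerUnipotent (k : Fin 4) :
    ((lowerUnipotent k)⁻¹ : SL(2, ℤ)).1 = !![1, 0; -(k : ℤ), 1] := by
  rw [Matrix.SpecialLinearGroup.SL2_inv_expl]
  simp [lowerUnipotent]
  rfl

/-- For `k = 0, 1, 2, 3` the matrices `lowerUnipotent k` send ∞ to ∞, 1 (equivalent to 0), 1/2 and
1/3, which represent all cusps of Γ₀(6). -/
lemma exists_eq_mul_lowerUnipotent_mul_zpow (γ : SL(2, ℤ)) :
    ∃ γ₀ ∈ CongruenceSubgroup.Gamma0 6, ∃ (k : Fin 4) (j : ℤ),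
      γ = γ₀ * lowerUnipotent k * ModularGroup.T ^ j := by
  have hdet := γ.det_coe
  rw [Matrix.det_fin_two] at hdet
  -- The expression is the lower left entry, modulo 6, of `γ * T ^ (-j) * (lowerUnipotent k)⁻¹`.
  have key : ∀ a b c d : ZMod 6, a * d - b * c = 1 →
      ∃ (k : Fin 4) (j : Fin 6), c - ((d - c * (j : ℕ)) * (k : ℕ)) = 0 := by decide
  obtain ⟨k, j, h⟩ := key (γ 0 0) (γ 0 1) (γ 1 0) (γ 1 1) (by exact_mod_cast congrArg _ hdet)
  refine ⟨γ * ModularGroup.T ^ (-(j : ℤ)) * (lowerUnipotent k)⁻¹, ?_, k, j, by simp⟩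
  rw [CongruenceSubgroup.Gamma0_mem, ← h]
  simp only [Matrix.SpecialLinearGroup.coe_mul, coe_inv_lowerUnipotent,
    ModularGroup.coe_T_zpow, Matrix.mul_apply, Fin.sum_univ_two]
  simp
  ring

variable {c : Fin 4 → ℂ} {e : Fin 4 → ℤ}

lemma isBigO_eisRatio_smul_of_forall_lowerUnipotent
    (hc : ∑ i, c i / divisor i = 0) (he : ∑ i, e i = 4)
    (h : ∀ k, (fun τ ↦ eisRatio c e (lowerUnipotent k • τ)) =O[atImInfty] fun _ ↦ (1 : ℝ))
    (γ : SL(2, ℤ)) : (fun τ ↦ eisRatio c e (γ • τ)) =O[atImInfty] fun _ ↦ (1 : ℝ) := by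
  obtain ⟨γ₀, hγ₀, k, j, rfl⟩ := exists_eq_mul_lowerUnipotent_mul_zpow γ
  have hT : Tendsto (fun τ : ℍ ↦ ModularGroup.T ^ j • τ) atImInfty atImInfty := by
    simp_rw [modular_T_zpow_smul]
    rw [atImInfty, tendsto_comap_iff]
    simpa [Function.comp_def] using tendsto_comap
  simpa only [mul_smul, eisRatio_smul_of_mem_Gamma0 hγ₀ hc he, Function.comp_def]
    using (h k).comp_tendsto hT

/-! ### Holomorphy and constancy of the ratio -/

lemma differentiableAt_eta_mul (d : ℕ+) {z : ℂ} (hz : 0 < z.im) :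
    DifferentiableAt ℂ (fun z ↦ eta (d * z)) z := by
  have : 0 < ((d : ℂ) * z).im := by simpa using hz
  exact (differentiableAt_eta_of_mem_upperHalfPlaneSet this).comp z (by fun_prop)

lemma coe_scale_ofComplex (d : ℕ+) {z : ℂ} (hz : 0 < z.im) :
    (scale d (ofComplex z) : ℂ) = d * z := by
  rw [coe_scale, ofComplex_apply_of_im_pos hz]

lemma differentiableOn_E2_scale (d : ℕ+) :
    DifferentiableOn ℂ (fun z ↦ E2 (scale d (ofComplex z))) {z | 0 < z.im} := by
  have h := UpperHalfPlane.mdifferentiable_iff.mp E2_mdifferentiable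
  have h2 : DifferentiableOn ℂ (fun z : ℂ ↦ (E2 ∘ ofComplex) (d * z)) {z | 0 < z.im} :=
    h.comp (by fun_prop) fun z hz ↦ by simpa using hz
  refine h2.congr fun z hz ↦ ?_
  have hz' : 0 < ((d : ℂ) * z).im := by simpa using hz
  simp only [Function.comp_apply]
  congr 1
  ext
  rw [coe_scale_ofComplex d hz, ofComplex_apply_of_im_pos hz']

lemma differentiableOn_eisSum (c : Fin 4 → ℂ) :
    DifferentiableOn ℂ (eisSum c ∘ ofComplex) {z | 0 < z.im} := by
  change DifferentiableOn ℂ (fun z ↦ ∑ i, c i * E2 (scale (divisor i) (ofComplex z))) _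
  exact DifferentiableOn.fun_sum fun i _ ↦ (differentiableOn_E2_scale _).const_mul _

/-- The eta quotient `∏ η(δ τ) ^ e_δ` over the divisors `δ` of `6`. -/
noncomputable def etaProd (e : Fin 4 → ℤ) (τ : ℍ) : ℂ :=
  ∏ i, ModularForm.eta (scale (divisor i) τ) ^ e i

lemma etaProd_ne_zero (e : Fin 4 → ℤ) (τ : ℍ) : etaProd e τ ≠ 0 :=
  Finset.prod_ne_zero_iff.mpr fun _ _ ↦ zpow_ne_zero _ (eta_ne_zero (scale _ _).im_pos)

lemma etaProd_pow (e : Fin 4 → ℤ) (τ : ℍ) : etaProd e τ ^ 24 = discProd e τ := by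
  rw [etaProd, discProd, ← Finset.prod_pow]
  refine Finset.prod_congr rfl fun i _ ↦ ?_
  rw [discriminant, ← zpow_natCast, zpow_comm, zpow_natCast]

lemma differentiableOn_etaProd (e : Fin 4 → ℤ) :
    DifferentiableOn ℂ (etaProd e ∘ ofComplex) {z | 0 < z.im} := by
  have : DifferentiableOn ℂ (fun z : ℂ ↦ ∏ i, ModularForm.eta (divisor i * z) ^ e i)
      {z | 0 < z.im} := by
    refine DifferentiableOn.fun_finsetProd fun i _ z hz ↦ ?_
    have hz' : 0 < ((divisor i : ℂ) * z).im := by simpa using hz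
    exact ((differentiableAt_eta_mul (divisor i) hz).zpow
      (Or.inl (eta_ne_zero hz'))).differentiableWithinAt
  refine this.congr fun z hz ↦ ?_
  simp only [Function.comp_apply, etaProd, coe_scale_ofComplex _ hz]

lemma eisRatio_eq (c : Fin 4 → ℂ) (e : Fin 4 → ℤ) (τ : ℍ) :
    eisRatio c e τ = (eisSum c τ / etaProd e τ) ^ 24 := by
  rw [eisRatio, div_pow, etaProd_pow]

lemma differentiableOn_eisSum_div_etaProd (c : Fin 4 → ℂ) (e : Fin 4 → ℤ) :
    DifferentiableOn ℂ ((fun τ ↦ eisSum c τ / etaProd e τ) ∘ ofComplex) {z | 0 < z.im} :=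
  (differentiableOn_eisSum c).div (differentiableOn_etaProd e) fun _ _ ↦ etaProd_ne_zero _ _

open CongruenceSubgroup in
lemma exists_eisRatio_eq_const (hc : ∑ i, c i / divisor i = 0) (he : ∑ i, e i = 4)
    (h : ∀ k, (fun τ ↦ eisRatio c e (lowerUnipotent k • τ)) =O[atImInfty] fun _ ↦ (1 : ℝ)) :
    ∃ C, ∀ τ, eisRatio c e τ = C := by
  let f : ModularForm ((Gamma0 6).map (Matrix.SpecialLinearGroup.mapGL ℝ)) 0 :=
    { toFun := eisRatio c e
      slash_action_eq' := by
        rintro _ ⟨γ, hγ, rfl⟩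
        ext τ
        change (eisRatio c e ∣[(0 : ℤ)] γ) τ = _
        rw [SL_slash_apply]
        simpa using eisRatio_smul_of_mem_Gamma0 hγ hc he τ
      holo' := by
        rw [UpperHalfPlane.mdifferentiable_iff]
        refine ((differentiableOn_eisSum_div_etaProd c e).pow 24).congr fun z _ ↦ ?_
        exact eisRatio_eq c e _
      bdd_at_cusps' := by
        intro x hx
        rw [Subgroup.IsArithmetic.isCusp_iff_isCusp_SL2Z] at hx
        rw [OnePoint.isBoundedAt_iff_forall_SL2Z hx]
        intro γ _
        rw [SL_slash_def]
        simp only [neg_zero, zpow_zero, mul_one]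
        exact isBigO_eisRatio_smul_of_forall_lowerUnipotent hc he h γ }
  obtain ⟨C, hC⟩ := ModularForm.eq_const_of_weight_zero f
  exact ⟨C, fun τ ↦ congrFun hC τ⟩

/-! ### Leading terms at i∞ -/

section limits

local notation "𝕢" => Function.Periodic.qParam

lemma tendsto_tprod_one_sub_eta_q :
    Tendsto (fun τ : ℍ ↦ ∏' n, (1 - eta_q n τ)) atImInfty (𝓝 1) := by
  have h0 : (0 : ℂ) ∈ Metric.ball (0 : ℂ) 1 := Metric.mem_ball_self one_pos
  have h := (differentiableOn_tprod_one_sub_pow.differentiableAt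
    (Metric.isOpen_ball.mem_nhds h0)).continuousAt.tendsto
  simpa [Function.comp_def, eta_q] using h.comp (qParam_tendsto_atImInfty one_pos)

lemma prod_qParam_zpow {e : Fin 4 → ℤ} {m : ℕ} (hm : ∑ i, e i * (divisor i : ℤ) = 24 * m)
    (τ : ℍ) : ∏ i, 𝕢 24 (divisor i * τ : ℂ) ^ e i = 𝕢 1 (τ : ℂ) ^ m := by
  have hm' : ∑ i, (e i : ℂ) * (divisor i : ℂ) = 24 * m := by exact_mod_cast hm
  simp only [Function.Periodic.qParam, ← Complex.exp_int_mul, ← Complex.exp_sum,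
    ← Complex.exp_nat_mul]
  congr 1
  calc ∑ i, (e i : ℂ) * (2 * π * I * (divisor i * τ) / (24 : ℝ))
      = (∑ i, (e i : ℂ) * (divisor i : ℂ)) * (2 * π * I * τ / 24) := by
        rw [Finset.sum_mul]
        exact Finset.sum_congr rfl fun i _ ↦ by push_cast; ring
    _ = m * (2 * π * I * τ / (1 : ℝ)) := by
        rw [hm']
        push_cast
        ring

lemma tendsto_etaProd_div_qParam {e : Fin 4 → ℤ} {m : ℕ}
    (hm : ∑ i, e i * (divisor i : ℤ) = 24 * m) :
    Tendsto (fun τ : ℍ ↦ etaProd e τ / 𝕢 1 (τ : ℂ) ^ m) atImInfty (𝓝 1) := by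
  have h := tendsto_finsetProd Finset.univ fun (i : Fin 4) _ ↦
    (tendsto_tprod_one_sub_eta_q.comp (tendsto_scale (divisor i))).zpow₀ (e i) (Or.inl one_ne_zero)
  simp only [one_zpow, Finset.prod_const_one, Function.comp_apply] at h
  refine h.congr fun τ ↦ ?_
  rw [eq_div_iff (pow_ne_zero _ (Function.Periodic.qParam_ne_zero _)), ← prod_qParam_zpow hm τ,
    ← Finset.prod_mul_distrib]
  refine Finset.prod_congr rfl fun i _ ↦ ?_
  rw [← mul_zpow, mul_comm, coe_scale, ModularForm.eta]

lemma tendsto_eisSum (c : Fin 4 → ℂ) : Tendsto (eisSum c) atImInfty (𝓝 (∑ i, c i)) := by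
  have hE : Tendsto E2 atImInfty (𝓝 1) := by
    have h := tendsto_E2_sub_one_div_qParam.mul (qParam_tendsto_atImInfty one_pos)
    have h' := h.add_const 1
    rw [mul_zero, zero_add] at h'
    refine h'.congr fun τ ↦ ?_
    rw [div_mul_cancel₀ _ (Function.Periodic.qParam_ne_zero _), sub_add_cancel]
  refine tendsto_finsetSum _ fun i _ ↦ ?_
  simpa using (hE.comp (tendsto_scale (divisor i))).const_mul (c i)

lemma qParam_scale (d : ℕ+) (τ : ℍ) : 𝕢 1 (scale d τ : ℂ) = 𝕢 1 (τ : ℂ) ^ (d : ℕ) := by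
  rw [coe_scale]
  simp only [Function.Periodic.qParam, ← Complex.exp_nat_mul]
  congr 1
  ring

/-- `E₂(dτ) - 1` begins with `-24 q^d`; the power of zero is 1 for `d = 1` and 0 otherwise. -/
lemma tendsto_E2_scale_sub_one_div_qParam (d : ℕ+) :
    Tendsto (fun τ ↦ (E2 (scale d τ) - 1) / 𝕢 1 (τ : ℂ)) atImInfty
      (𝓝 (-24 * (0 : ℂ) ^ ((d : ℕ) - 1))) := by
  refine ((tendsto_E2_sub_one_div_qParam.comp (tendsto_scale d)).mul
    ((qParam_tendsto_atImInfty one_pos).pow ((d : ℕ) - 1))).congr fun τ ↦ ?_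
  have hq : 𝕢 1 (τ : ℂ) ≠ 0 := Function.Periodic.qParam_ne_zero _
  simp only [Function.comp_apply]
  have hpow : 𝕢 1 (τ : ℂ) ^ (d : ℕ) = 𝕢 1 (τ : ℂ) ^ ((d : ℕ) - 1) * 𝕢 1 (τ : ℂ) := by
    rw [← pow_succ, Nat.sub_add_cancel d.pos]
  rw [qParam_scale, hpow]
  field_simp

lemma tendsto_eisSum_div_qParam {c : Fin 4 → ℂ} (hc : ∑ i, c i = 0) :
    Tendsto (fun τ ↦ eisSum c τ / 𝕢 1 (τ : ℂ)) atImInfty (𝓝 (-24 * c 0)) := by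
  have h : Tendsto (fun τ : ℍ ↦ ∑ i, c i * ((E2 (scale (divisor i) τ) - 1) / 𝕢 1 (τ : ℂ)))
      atImInfty (𝓝 (∑ i, c i * (-24 * (0 : ℂ) ^ ((divisor i : ℕ) - 1)))) :=
    tendsto_finsetSum _ fun i _ ↦ (tendsto_E2_scale_sub_one_div_qParam _).const_mul _
  have hL : ∑ i, c i * (-24 * (0 : ℂ) ^ ((divisor i : ℕ) - 1)) = -24 * c 0 := by
    rw [Fin.sum_univ_four]
    simp [divisor]
    ring
  rw [hL] at h
  refine h.congr fun τ ↦ ?_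
  have : eisSum c τ = ∑ i, c i * (E2 (scale (divisor i) τ) - 1) := by
    simp only [mul_sub, mul_one, Finset.sum_sub_distrib, hc, sub_zero, eisSum]
  rw [this, Finset.sum_div]
  exact Finset.sum_congr rfl fun i _ ↦ by ring

end limits

lemma eq_of_pow_eq_const {X : Type*} [TopologicalSpace X] [PreconnectedSpace X] {g : X → ℂ}
    (hg : Continuous g) {n : ℕ} (hn : 0 < n) {C : ℂ} (h : ∀ x, g x ^ n = C) (x y : X) :
    g x = g y := by
  have hfin : {z : ℂ | z ^ n = C}.Finite :=
    (Polynomial.nthRoots n C).toFinset.finite_toSet.subset fun z hz ↦ by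
      simpa [Polynomial.mem_nthRoots hn] using hz
  exact hfin.countable.isTotallyDisconnected (Set.range g) (by rintro _ ⟨x, rfl⟩; exact h x)
    (isPreconnected_range hg) ⟨x, rfl⟩ ⟨y, rfl⟩

lemma eisSum_eq_mul_etaProd {c : Fin 4 → ℂ} {e : Fin 4 → ℤ} {r : Fin 4 → ℝ}
    (hcδ : ∑ i, c i / divisor i = 0) (he : ∑ i, e i = 4)
    (hr : ∀ k i, r k ≤ cuspA k i / cuspD k i)
    (hc : ∀ k, r k = 0 ∨ ∑ i, c i / (cuspD k i : ℂ) ^ 2 = 0)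
    (hord : ∀ k, ∑ i, e i * (cuspA k i / cuspD k i : ℝ) ≤ 24 * r k) {L : ℂ}
    (hL : Tendsto (fun τ ↦ eisSum c τ / etaProd e τ) atImInfty (𝓝 L)) (τ : ℍ) :
    eisSum c τ = L * etaProd e τ := by
  obtain ⟨C, hC⟩ := exists_eisRatio_eq_const hcδ he fun k ↦
    isBigO_eisRatio_smul (isTriangular_lowerUnipotent k) hcδ he (hr k) (hc k) (hord k)
  have hcont : Continuous fun τ ↦ eisSum c τ / etaProd e τ :=
    (UpperHalfPlane.mdifferentiable_iff.mpr (differentiableOn_eisSum_div_etaProd c e)).continuous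
  have hconst := eq_of_pow_eq_const hcont (by norm_num : 0 < 24)
    fun τ ↦ (eisRatio_eq c e τ).symm.trans (hC τ)
  have hτ : eisSum c τ / etaProd e τ = L :=
    tendsto_nhds_unique (tendsto_const_nhds.congr (hconst τ)) hL
  rw [← hτ, div_mul_cancel₀ _ (etaProd_ne_zero e τ)]

/-! ### The two identities and the zeros of 1 - 5t₆ -/

lemma etaAt_ne_zero (d : ℕ+) (τ : ℍ) : etaAt d τ ≠ 0 := eta_ne_zero (scale d τ).im_pos

lemma t6_ne_zero (τ : ℍ) : t6 τ ≠ 0 := by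
  simp [t6, etaAt_ne_zero]

lemma Eb_eq_etaProd (τ : ℍ) : Eb τ = etaProd ![-5, 7, 7, -5] τ := by
  simp only [Eb, etaProd, Fin.prod_univ_four, divisor, etaAt]
  simp [zpow_neg, zpow_ofNat]
  field_simp

lemma t6_eq_etaProd (τ : ℍ) : t6 τ = etaProd ![12, -12, -12, 12] τ := by
  simp only [t6, etaProd, Fin.prod_univ_four, divisor, etaAt]
  simp [zpow_neg, zpow_ofNat]
  field_simp

lemma etaProd_mul (e e' : Fin 4 → ℤ) (τ : ℍ) :
    etaProd e τ * etaProd e' τ = etaProd (e + e') τ := by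
  simp only [etaProd, ← Finset.prod_mul_distrib]
  refine Finset.prod_congr rfl fun i _ ↦ ?_
  rw [Pi.add_apply, zpow_add₀ (eta_ne_zero (scale (divisor i) τ).im_pos)]

lemma Eb_mul_t6_eq_etaProd (τ : ℍ) : Eb τ * t6 τ = etaProd ![7, -5, -5, 7] τ := by
  rw [Eb_eq_etaProd, t6_eq_etaProd, etaProd_mul]
  simp

lemma E60_eq (τ : ℍ) : E60 τ = -24 * (Eb τ * t6 τ) := by
  rw [Eb_mul_t6_eq_etaProd]
  have h : E60 τ = eisSum ![1, -10, 15, -6] τ := by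
    simp [E60, eisSum, Fin.sum_univ_four, divisor, E2At]
    ring
  rw [h]
  -- `r k` bounds below the order in q at the cusps ∞, 0, 1/2, 1/3. Each positive entry is the least
  -- `a i / d i` at its cusp, and 24 times each `r k` is exactly the order of the discriminant
  -- product.
  refine eisSum_eq_mul_etaProd (r := ![1, 1 / 6, 0, 0]) ?_ ?_ ?_ ?_ ?_ ?_ τ
  · simp [Fin.sum_univ_four, divisor]
    norm_num
  · simp [Fin.sum_univ_four]
  · intro k i
    fin_cases k <;> fin_cases i <;> simp [cuspA, cuspD] <;> norm_num
  · intro k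
    fin_cases k <;> simp [cuspD, Fin.sum_univ_four] <;> norm_num
  · intro k
    fin_cases k <;> simp [cuspA, cuspD, Fin.sum_univ_four] <;> norm_num
  · have h1 := tendsto_eisSum_div_qParam (c := ![1, -10, 15, -6])
      (by simp [Fin.sum_univ_four]; norm_num)
    have h2 := tendsto_etaProd_div_qParam (e := ![7, -5, -5, 7]) (m := 1)
      (by simp [Fin.sum_univ_four, divisor])
    have h3 := h1.div h2 one_ne_zero
    simp only [Matrix.cons_val_zero, mul_one, div_one] at h3
    refine h3.congr fun τ ↦ ?_
    simp only [Pi.div_apply, pow_one]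
    exact div_div_div_cancel_right₀ (Function.Periodic.qParam_ne_zero _) _ _

lemma E61_eq (τ : ℍ) : E61 τ - 5 / 24 * E60 τ = Eb τ := by
  rw [Eb_eq_etaProd]
  have h : E61 τ - 5 / 24 * E60 τ = eisSum ![-5 / 24, 2 / 24, -3 / 24, 30 / 24] τ := by
    simp [E60, E61, eisSum, Fin.sum_univ_four, divisor, E2At]
    ring
  rw [h, ← one_mul (etaProd _ τ)]
  -- Here the forced zeros lie at 1/2 and 1/3, so at i∞ the constant terms, both 1, determine the
  -- factor.
  refine eisSum_eq_mul_etaProd (r := ![0, 0, 1 / 3, 1 / 2]) ?_ ?_ ?_ ?_ ?_ ?_ τ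
  · simp [Fin.sum_univ_four, divisor]
    norm_num
  · simp [Fin.sum_univ_four]
  · intro k i
    fin_cases k <;> fin_cases i <;> simp [cuspA, cuspD] <;> norm_num
  · intro k
    fin_cases k <;> simp [cuspD, Fin.sum_univ_four] <;> norm_num
  · intro k
    fin_cases k <;> simp [cuspA, cuspD, Fin.sum_univ_four] <;> norm_num
  · have h1 := tendsto_eisSum ![-5 / 24, 2 / 24, -3 / 24, 30 / 24]
    have h2 := tendsto_etaProd_div_qParam (e := ![-5, 7, 7, -5]) (m := 0)
      (by simp [Fin.sum_univ_four, divisor])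
    have h3 := h1.div h2 one_ne_zero
    have hs : ∑ i, (![-5 / 24, 2 / 24, -3 / 24, 30 / 24] : Fin 4 → ℂ) i = 1 := by
      simp [Fin.sum_univ_four]
      norm_num
    rw [hs, div_one] at h3
    simpa only [pow_zero, div_one] using! h3

lemma tendsto_t6 : Tendsto t6 atImInfty (𝓝 0) := by
  have h := (tendsto_etaProd_div_qParam (e := ![12, -12, -12, 12]) (m := 1)
    (by simp [Fin.sum_univ_four, divisor])).mul (qParam_tendsto_atImInfty one_pos)
  rw [mul_zero] at h
  refine h.congr fun τ ↦ ?_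
  rw [pow_one, div_mul_cancel₀ _ (Function.Periodic.qParam_ne_zero _), t6_eq_etaProd]

/-- By the identity theorem, accumulating zeros would make `1 - 5 t6` vanish identically, whereas it
tends to 1 at i∞. -/
lemma eventually_one_sub_five_mul_t6_ne_zero (τ : ℍ) : ∀ᶠ w in 𝓝[≠] τ, 1 - 5 * t6 w ≠ 0 := by
  by_contra hfreq
  have hd : DifferentiableOn ℂ (fun z ↦ 1 - 5 * t6 (ofComplex z)) {z | 0 < z.im} := by
    simp_rw [t6_eq_etaProd]
    exact (differentiableOn_const 1).sub ((differentiableOn_etaProd _).const_mul 5)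
  have hcoe : Tendsto ((↑) : ℍ → ℂ) (𝓝[≠] τ) (𝓝[≠] (τ : ℂ)) :=
    tendsto_nhdsWithin_iff.mpr ⟨continuous_coe.continuousAt.mono_left nhdsWithin_le_nhds,
      eventually_nhdsWithin_of_forall fun w hw h ↦ hw (UpperHalfPlane.ext h)⟩
  have hzero : ∃ᶠ z in 𝓝[≠] (τ : ℂ), 1 - 5 * t6 (ofComplex z) = 0 := by
    refine hcoe.frequently ((not_eventually.mp hfreq).mono fun w hw ↦ ?_)
    rw [ofComplex_apply]
    exact not_not.mp hw
  have heq := (hd.analyticOnNhd isOpen_upperHalfPlaneSet)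
    |>.eqOn_zero_of_preconnected_of_frequently_eq_zero
      (convex_halfSpace_im_gt 0).isPreconnected τ.im_pos hzero
  have hlim : Tendsto (fun w : ℍ ↦ 1 - 5 * t6 w) atImInfty (𝓝 (1 - 5 * 0)) :=
    (tendsto_t6.const_mul 5).const_sub 1
  have h0 : (fun w : ℍ ↦ 1 - 5 * t6 w) = fun _ ↦ 0 := by
    ext w
    simpa using heq w.im_pos
  rw [h0] at hlim
  simpa using tendsto_nhds_unique hlim tendsto_const_nhds

end LevelSix

/-- The two level six identities, in product form at every point of the upper half-plane, and in
quotient form: `t₆` has no zeros, and the zeros of `1 - 5 t₆` are isolated, so that the second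
quotient identity, which is asserted away from them, is one of meromorphic functions. -/
theorem mainTheorem2 :
    (∀ τ : ℍ, LevelSix.Eb τ * LevelSix.t6 τ = -(1 / 24 : ℂ) * LevelSix.E60 τ) ∧
    (∀ τ : ℍ, LevelSix.Eb τ * (1 - 5 * LevelSix.t6 τ) = LevelSix.E61 τ) ∧
    (∀ τ : ℍ, LevelSix.t6 τ ≠ 0 ∧
      LevelSix.Eb τ = -(1 / 24 : ℂ) * (LevelSix.E60 τ / LevelSix.t6 τ)) ∧
    (∀ τ : ℍ, ∀ᶠ w in 𝓝[≠] τ, 1 - 5 * LevelSix.t6 w ≠ 0) ∧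
    (∀ τ : ℍ, 1 - 5 * LevelSix.t6 τ ≠ 0 →
      LevelSix.Eb τ = LevelSix.E61 τ / (1 - 5 * LevelSix.t6 τ)) := by
 
  have h1 (τ : ℍ) : LevelSix.Eb τ * LevelSix.t6 τ = -(1 / 24 : ℂ) * LevelSix.E60 τ := by
    rw [LevelSix.E60_eq]
    ring
  have h2 (τ : ℍ) : LevelSix.Eb τ * (1 - 5 * LevelSix.t6 τ) = LevelSix.E61 τ := by
    linear_combination -5 * h1 τ - LevelSix.E61_eq τ
  refine ⟨h1, h2, fun τ ↦ ⟨LevelSix.t6_ne_zero τ, ?_⟩,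
    LevelSix.eventually_one_sub_five_mul_t6_ne_zero, fun τ hτ ↦ ?_⟩
  · rw [← mul_div_assoc, ← h1, mul_div_cancel_right₀ _ (LevelSix.t6_ne_zero τ)]
  · rw [← h2, mul_div_cancel_right₀ _ hτ]
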